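/- Let $(\theta_n)_{n\ge 0}$ be the Ramanujan sequence, defined by $\theta_0=\tfrac12$ and $$\theta_n=\Big(\frac{e^n}{2}-\sum_{k=0}^{n-1}\frac{n^k}{k!}\Big)\frac{n!}{n^n}\qquad(n\ge 1).$$ There is a probability distribution function $G$ on $[0,1]$ such that $$(n+1)\Big(\theta_n-\frac13\Big)=\frac{4}{135}+\frac{37}{270}\int_{[0,1]}x^n\,dG(x)\qquad\text{for all } n\ge 0.$$ As a consequence, the sequence $a_n:=(n+1)\big(\theta_n-\tfrac13\big)$, $n\ge 0$, is completely monotone, that is, $$\sum_{m=0}^{n}\binom nm(-1)^m a_{k+m}\ge 0\qquad\text{for all } k\ge 0,\ n\ge 0.$$ -/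

import Mathlib

open MeasureTheory

/-- The Ramanujan sequence: `θ₀ = 1/2` and
`θₙ = (eⁿ / 2 - ∑_{k=0}^{n-1} nᵏ / k!) * (n! / nⁿ)` for `n ≥ 1`. -/
noncomputable def ramanujanTheta (n : ℕ) : ℝ :=
  if n = 0 then 1 / 2
  else (Real.exp (n : ℝ) / 2 - ∑ k ∈ Finset.range n, (n : ℝ) ^ k / (Nat.factorial k : ℝ)) *
    ((Nat.factorial n : ℝ) / (n : ℝ) ^ n)

/-- A real sequence `a` is completely monotone if all its alternating differences
`∑_{m=0}^{n} (n choose m) (-1)^m a_{k+m}` are nonnegative. -/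
def CompletelyMonotoneSeq (a : ℕ → ℝ) : Prop :=
  ∀ k n : ℕ, 0 ≤ ∑ m ∈ Finset.range (n + 1), (Nat.choose n m : ℝ) * (-1) ^ m * a (k + m)

/-- `G` (nondecreasing and right-continuous on `ℝ`, as a `StieltjesFunction`) is a probability
distribution function on `[0,1]`: it vanishes to the left of `0` and equals `1` from `1` on.
Its Lebesgue–Stieltjes measure `G.measure` is then a probability measure carried by `[0,1]`,
possibly with an atom at `0`. -/
structure IsProbDistributionOnUnitInterval (G : StieltjesFunction ℝ) : Prop where
  eq_zero : ∀ x : ℝ, x < 0 → G x = 0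
  eq_one : ∀ x : ℝ, 1 ≤ x → G x = 1

/-! For `n ≥ 1`, `stirlingFactor n * erlangTail n (n * y)` has y-derivative -(n/2) (y e^(1-y))^n /
y, so θ_n is the integral of (n/2) (y e^(1-y))^n / y over (0,1) minus that over (1,∞). The
substitution x = y e^(1-y) folds both ranges onto (0,1), with preimages u < 1 < v, and gives θ_n =
(n/2) ∫ x^(n-1) R dx with R = 1/(1-u) + 1/(1-v). Put C = -x R'. Two integrations by parts, with R =
2/3 and C = 8/135 at x = 1, yield (n+1)(θ_n - 1/3) = 4/135 + (1/2) ∫ x^(n-1) (C - x C') dx, where C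
- x C' is the sum of y²(y-4)/(y-1)⁵ over y = u, v. The case n = 0 fixes the total mass 37/270.

What remains is the sign of that sum, `branch_sum_nonneg`. Only v < 4 contributes negatively; there
u is bounded below through a rational barrier, and the rest is polynomial positivity.

The gap τ = v - u makes both branches elementary. The integrations by parts are packed into
`momentPrimitive`, whose limits at τ = 0 and τ = ∞ give the moments
(`moment_integrable_and_integral`). -/

open Filter Topology

/-! ### Positivity of the density: comparison of the two branches -/

/-- The level function of the branch of `w - log (1 + w) = t` with `w < 0`, in terms of
`b = -1 - 1 / w`. -/
noncomputable def lowerLevel (b : ℝ) : ℝ := Real.log (1 + b) - Real.log b - 1 / (1 + b)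

/-- The level function of the branch of `w - log (1 + w) = t` with `w > 0`, in terms of
`a = 1 / w`. -/
noncomputable def upperLevel (a : ℝ) : ℝ := 1 / a - Real.log (1 + a) + Real.log a

theorem hasDerivAt_lowerLevel {b : ℝ} (hb : 0 < b) :
    HasDerivAt lowerLevel (-1 / (b * (1 + b) ^ 2)) b := by
  have h1 : HasDerivAt (fun b : ℝ => 1 + b) 1 b := (hasDerivAt_id b).const_add 1
  have h := ((h1.log (by positivity)).sub (Real.hasDerivAt_log hb.ne')).sub
    ((hasDerivAt_const b (1 : ℝ)).div h1 (by positivity))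
  refine h.congr_deriv ?_
  field_simp
  ring

theorem hasDerivAt_upperLevel {a : ℝ} (ha : 0 < a) :
    HasDerivAt upperLevel (-1 / (a ^ 2 * (1 + a))) a := by
  have h1 : HasDerivAt (fun b : ℝ => 1 + b) 1 a := (hasDerivAt_id a).const_add 1
  have h := (((hasDerivAt_const a (1 : ℝ)).div (hasDerivAt_id a) ha.ne').sub
    (h1.log (by positivity))).add (Real.hasDerivAt_log ha.ne')
  refine h.congr_deriv ?_
  simp only [id]
  field_simp
  ring

theorem strictAntiOn_lowerLevel : StrictAntiOn lowerLevel (Set.Ioi 0) := by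
  refine strictAntiOn_of_deriv_neg (convex_Ioi 0)
    (fun b hb => (hasDerivAt_lowerLevel hb).continuousAt.continuousWithinAt) fun b hb => ?_
  rw [interior_Ioi] at hb
  have hb' : (0 : ℝ) < b := hb
  rw [(hasDerivAt_lowerLevel hb).deriv]
  exact div_neg_of_neg_of_pos (by norm_num) (by positivity)

theorem tendsto_log_one_add_sub_log_atTop :
    Tendsto (fun b : ℝ => Real.log (1 + b) - Real.log b) atTop (𝓝 0) := by
  have h : Tendsto (fun b : ℝ => Real.log (1 + b⁻¹)) atTop (𝓝 0) := by
    have := (tendsto_inv_atTop_zero (𝕜 := ℝ)).const_add 1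
    simpa using this.log (by norm_num)
  refine h.congr' ?_
  filter_upwards [eventually_gt_atTop 0] with b hb
  rw [← Real.log_div (by positivity) hb.ne']
  congr 1
  field_simp
  ring

theorem tendsto_lowerLevel_atTop : Tendsto lowerLevel atTop (𝓝 0) := by
  have h : Tendsto (fun b : ℝ => 1 / (1 + b)) atTop (𝓝 0) := by
    simpa [Function.comp_def] using
      (tendsto_inv_atTop_zero (𝕜 := ℝ)).comp (tendsto_atTop_add_const_left _ 1 tendsto_id)
  have h2 := tendsto_log_one_add_sub_log_atTop.sub h
  rwa [sub_zero] at h2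

theorem tendsto_upperLevel_atTop : Tendsto upperLevel atTop (𝓝 0) := by
  have h : Tendsto (fun b : ℝ => 1 / b) atTop (𝓝 0) := by
    simpa using tendsto_inv_atTop_zero (𝕜 := ℝ)
  have := h.sub tendsto_log_one_add_sub_log_atTop
  simp only [sub_zero] at this
  refine this.congr fun a => ?_
  simp only [upperLevel]
  ring

/-- A rational lower bound for `b` in terms of `q = 3 a - 1`, where
`lowerLevel b = upperLevel a`. -/
noncomputable def levelBarrier (q : ℝ) : ℝ := q / 3 + 4 / (15 * (q + 2) ^ 2 - 9)

theorem levelBarrier_pos {q : ℝ} (hq : 0 < q) : 0 < levelBarrier q := by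
  have h : 0 < 15 * (q + 2) ^ 2 - 9 := by nlinarith
  unfold levelBarrier
  positivity

theorem hasDerivAt_levelBarrier {q : ℝ} (hq : 0 < q) :
    HasDerivAt levelBarrier (1 / 3 - 120 * (q + 2) / (15 * (q + 2) ^ 2 - 9) ^ 2) q := by
  have h : 15 * (q + 2) ^ 2 - 9 ≠ 0 := by nlinarith
  have h1 : HasDerivAt (fun q : ℝ => 15 * (q + 2) ^ 2 - 9) (30 * (q + 2)) q := by
    refine (((((hasDerivAt_id q).add_const 2).pow 2).const_mul 15).sub_const 9).congr_deriv ?_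
    simp only [id]
    ring
  refine (((hasDerivAt_id q).div_const 3).add ((hasDerivAt_const q (4 : ℝ)).div h1 h)).congr_deriv ?_
  ring

/-- This is the sign of the derivative of `lowerLevel (levelBarrier q) - upperLevel ((q + 1) / 3)`,
rearranged. -/
theorem levelBarrier_deriv_bound {q : ℝ} (hq : 0 < q) :
    1 / (3 * (((q + 1) / 3) ^ 2 * (1 + (q + 1) / 3))) ≤
      (1 / 3 - 120 * (q + 2) / (15 * (q + 2) ^ 2 - 9) ^ 2) /
        (levelBarrier q * (1 + levelBarrier q) ^ 2) := by
  have hb := levelBarrier_pos hq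
  rw [div_le_div_iff₀ (by positivity) (by positivity), ← sub_nonneg]
  unfold levelBarrier
  -- D stays opaque while denominators are cleared; once it is expanded, the numerator is a
  -- polynomial in q with only nonnegative coefficients.
  obtain ⟨D, hD⟩ : ∃ D, D = 15 * (q + 2) ^ 2 - 9 := ⟨_, rfl⟩
  have hD0 : 0 < D := by rw [hD]; nlinarith
  rw [← hD]
  have key : (1 / 3 - 120 * (q + 2) / D ^ 2) * (3 * (((q + 1) / 3) ^ 2 * (1 + (q + 1) / 3))) -
      1 * ((q / 3 + 4 / D) * (1 + (q / 3 + 4 / D)) ^ 2) =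
      ((D ^ 2 - 360 * (q + 2)) * (q + 1) ^ 2 * (q + 4) * D
        - (q * D + 12) * ((q + 3) * D + 12) ^ 2) / (27 * D ^ 3) := by
    field_simp
    ring
  rw [key]
  refine div_nonneg ?_ (by positivity)
  rw [hD]
  ring_nf
  positivity

theorem levelBarrier_weight_bound {q : ℝ} (hq : 0 < q) :
    ((q + 1) / 3) ^ 2 * (1 + (q + 1) / 3) ^ 2 * q ≤
      levelBarrier q ^ 2 * (1 + levelBarrier q) ^ 2 * (4 + 3 * levelBarrier q) := by
  rw [← sub_nonneg]
  unfold levelBarrier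
  obtain ⟨D, hD⟩ : ∃ D, D = 15 * (q + 2) ^ 2 - 9 := ⟨_, rfl⟩
  have hD0 : 0 < D := by rw [hD]; nlinarith
  rw [← hD]
  have key : (q / 3 + 4 / D) ^ 2 * (1 + (q / 3 + 4 / D)) ^ 2 * (4 + 3 * (q / 3 + 4 / D)) -
      ((q + 1) / 3) ^ 2 * (1 + (q + 1) / 3) ^ 2 * q =
      ((q * D + 12) ^ 2 * ((q + 3) * D + 12) ^ 2 * ((q + 4) * D + 12) -
        (q + 1) ^ 2 * (q + 4) ^ 2 * q * D ^ 5) / (81 * D ^ 5) := by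
    field_simp
    ring
  rw [key]
  refine div_nonneg ?_ (by positivity)
  rw [hD]
  ring_nf
  positivity

/-- The difference of the two sides is monotone in q and vanishes at infinity, so its sign is known
everywhere. The barrier is close enough for this because, with q = 3a - 1, the true b is a - 1/3 +
4/(135a²) - 8/(405a³) + O(a⁻⁴), and `levelBarrier` has the same terms through a⁻³. -/
theorem upperLevel_le_lowerLevel_levelBarrier {q : ℝ} (hq : 0 < q) :
    upperLevel ((q + 1) / 3) ≤ lowerLevel (levelBarrier q) := by
  have hd : ∀ q : ℝ, 0 < q → HasDerivAt
      (fun q => lowerLevel (levelBarrier q) - upperLevel ((q + 1) / 3))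
      (-1 / (levelBarrier q * (1 + levelBarrier q) ^ 2) *
        (1 / 3 - 120 * (q + 2) / (15 * (q + 2) ^ 2 - 9) ^ 2) -
        -1 / (((q + 1) / 3) ^ 2 * (1 + (q + 1) / 3)) * (1 / 3)) q := fun q hq =>
    ((hasDerivAt_lowerLevel (levelBarrier_pos hq)).comp q (hasDerivAt_levelBarrier hq)).sub
      ((hasDerivAt_upperLevel (by positivity)).comp q (((hasDerivAt_id q).add_const 1).div_const 3))
  have hanti : AntitoneOn (fun q => lowerLevel (levelBarrier q) - upperLevel ((q + 1) / 3))
      (Set.Ioi 0) := by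
    refine antitoneOn_of_deriv_nonpos (convex_Ioi 0)
      (fun q hq => (hd q hq).continuousAt.continuousWithinAt)
      (fun q hq => ?_) fun q hq => ?_
    · rw [interior_Ioi] at hq
      exact (hd q hq).differentiableAt.differentiableWithinAt
    · rw [interior_Ioi] at hq
      rw [(hd q hq).deriv]
      have h := levelBarrier_deriv_bound (q := q) hq
      have e1 : 1 / (3 * (((q + 1) / 3) ^ 2 * (1 + (q + 1) / 3))) =
        1 / (((q + 1) / 3) ^ 2 * (1 + (q + 1) / 3)) * (1 / 3) := by
        rw [div_mul_div_comm, one_mul, mul_comm 3]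
      rw [e1, div_eq_mul_inv (1 / 3 - _)] at h
      rw [neg_div, neg_div, one_div (levelBarrier q * _)]
      linarith
  have hlim : Tendsto (fun q => lowerLevel (levelBarrier q) - upperLevel ((q + 1) / 3)) atTop
      (𝓝 0) := by
    have h1 : Tendsto levelBarrier atTop atTop := by
      refine tendsto_atTop_mono' (f₁ := fun q : ℝ => q / 3) _ ?_
        (tendsto_id.atTop_div_const (by norm_num))
      filter_upwards [eventually_gt_atTop 0] with q hq
      have h : 0 < 15 * (q + 2) ^ 2 - 9 := by nlinarith
      unfold levelBarrier
      have : 0 < 4 / (15 * (q + 2) ^ 2 - 9) := by positivity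
      linarith
    have h2 : Tendsto (fun q : ℝ => (q + 1) / 3) atTop atTop :=
      (tendsto_atTop_add_const_right _ 1 tendsto_id).atTop_div_const (by norm_num)
    simpa using (tendsto_lowerLevel_atTop.comp h1).sub (tendsto_upperLevel_atTop.comp h2)
  have : 0 ≤ lowerLevel (levelBarrier q) - upperLevel ((q + 1) / 3) := by
    refine le_of_tendsto hlim ?_
    filter_upwards [eventually_ge_atTop q] with r hr
    exact hanti hq (hq.trans_le hr) hr
  linarith

/-- The right side increases with b and `lowerLevel` decreases, so b may be replaced by the barrier.
When 3a ≤ 1 (that is, v ≥ 4) the left side is already nonpositive. -/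
theorem weight_le_of_level_eq {a b : ℝ} (ha : 0 < a) (hb : 0 < b)
    (h : lowerLevel b = upperLevel a) :
    a ^ 2 * (1 + a) ^ 2 * (3 * a - 1) ≤ b ^ 2 * (1 + b) ^ 2 * (4 + 3 * b) := by
  rcases le_or_gt (3 * a - 1) 0 with h0 | h0
  · exact (mul_nonpos_of_nonneg_of_nonpos (by positivity) h0).trans (by positivity)
  · have hβ := levelBarrier_pos h0
    have h1 := upperLevel_le_lowerLevel_levelBarrier h0
    have h2 := levelBarrier_weight_bound h0
    rw [show (3 * a - 1 + 1) / 3 = a by ring] at h1 h2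
    have hle : levelBarrier (3 * a - 1) ≤ b := by
      by_contra! hlt
      have := strictAntiOn_lowerLevel hb hβ hlt
      linarith
    refine h2.trans ?_
    gcongr

/-- The density inequality behind complete monotonicity: if `u < 1 < v` are the two solutions of
`y - log y = c`, then the sum over both of `y² (y - 4) / (y - 1)⁵` is nonnegative. -/
theorem branch_sum_nonneg {u v : ℝ} (hu : 0 < u) (hu1 : u < 1) (hv : 1 < v)
    (h : u - Real.log u = v - Real.log v) :
    0 ≤ v ^ 2 * (v - 4) / (v - 1) ^ 5 + u ^ 2 * (4 - u) / (1 - u) ^ 5 := by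
  have hv1 : 0 < v - 1 := sub_pos.2 hv
  have hu2 : 0 < 1 - u := sub_pos.2 hu1
  -- Both levels equal y - 1 - log y, at y = u and y = v respectively.
  have hlev : lowerLevel (u / (1 - u)) = upperLevel (1 / (v - 1)) := by
    have e1 : 1 + u / (1 - u) = 1 / (1 - u) := by field_simp; ring
    have e2 : 1 + 1 / (v - 1) = v / (v - 1) := by field_simp; ring
    unfold lowerLevel upperLevel
    rw [e1, e2, Real.log_div hu.ne' hu2.ne', Real.log_div (by positivity) hv1.ne',
      Real.log_div one_ne_zero hu2.ne', Real.log_div one_ne_zero hv1.ne', Real.log_one]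
    simp only [one_div_one_div]
    linarith
  have := weight_le_of_level_eq (a := 1 / (v - 1)) (b := u / (1 - u)) (by positivity)
    (by positivity) hlev
  have e1 : (1 / (v - 1)) ^ 2 * (1 + 1 / (v - 1)) ^ 2 * (3 * (1 / (v - 1)) - 1) =
      -(v ^ 2 * (v - 4) / (v - 1) ^ 5) := by field_simp; ring
  have e2 : (u / (1 - u)) ^ 2 * (1 + u / (1 - u)) ^ 2 * (4 + 3 * (u / (1 - u))) =
      u ^ 2 * (4 - u) / (1 - u) ^ 5 := by field_simp; ring
  linarith

/-! ### The two branches parametrised by their gap τ -/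

/-- The solution `u < 1` of `u * exp (-u) = v * exp (-v)`, `v - u = τ`. -/
noncomputable def lowerBranch (τ : ℝ) : ℝ := τ / (Real.exp τ - 1)

/-- The solution `v > 1` of `u * exp (-u) = v * exp (-v)`, `v - u = τ`. -/
noncomputable def upperBranch (τ : ℝ) : ℝ := lowerBranch τ + τ

/-- The common value of `y * exp (1 - y)` at the two branches. -/
noncomputable def branchValue (τ : ℝ) : ℝ :=
  lowerBranch τ * Real.exp (1 - lowerBranch τ)

theorem exp_sub_one_pos {τ : ℝ} (hτ : 0 < τ) : 0 < Real.exp τ - 1 :=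
  sub_pos.2 (Real.one_lt_exp_iff.2 hτ)

theorem lowerBranch_pos {τ : ℝ} (hτ : 0 < τ) : 0 < lowerBranch τ :=
  div_pos hτ (exp_sub_one_pos hτ)

theorem lowerBranch_lt_one {τ : ℝ} (hτ : 0 < τ) : lowerBranch τ < 1 := by
  rw [lowerBranch, div_lt_one (exp_sub_one_pos hτ)]
  linarith [Real.add_one_lt_exp hτ.ne']

theorem upperBranch_eq {τ : ℝ} (hτ : 0 < τ) :
    upperBranch τ = lowerBranch τ * Real.exp τ := by
  have := (exp_sub_one_pos hτ).ne'
  unfold upperBranch lowerBranch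
  field_simp
  ring

theorem upperBranch_eq_div {τ : ℝ} (hτ : 0 < τ) :
    upperBranch τ = τ / (1 - Real.exp (-τ)) := by
  have h := (exp_sub_one_pos hτ).ne'
  have h2 : 1 - Real.exp (-τ) ≠ 0 := by
    have := Real.exp_lt_one_iff.2 (neg_neg_of_pos hτ)
    linarith
  rw [upperBranch_eq hτ, lowerBranch, eq_div_iff h2, Real.exp_neg]
  field_simp

theorem one_lt_upperBranch {τ : ℝ} (hτ : 0 < τ) : 1 < upperBranch τ := by
  have h2 : 0 < 1 - Real.exp (-τ) := by
    have := Real.exp_lt_one_iff.2 (neg_neg_of_pos hτ)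
    linarith
  rw [upperBranch_eq_div hτ, lt_div_iff₀ h2]
  linarith [Real.add_one_lt_exp (neg_ne_zero.2 hτ.ne')]

theorem sub_log_branch_eq {τ : ℝ} (hτ : 0 < τ) :
    lowerBranch τ - Real.log (lowerBranch τ) = upperBranch τ - Real.log (upperBranch τ) := by
  rw [upperBranch_eq hτ, Real.log_mul (lowerBranch_pos hτ).ne' (Real.exp_pos _).ne', Real.log_exp,
    ← upperBranch_eq hτ, upperBranch]
  ring

theorem branchValue_eq_upper {τ : ℝ} (hτ : 0 < τ) :
    branchValue τ = upperBranch τ * Real.exp (1 - upperBranch τ) := by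
  rw [upperBranch_eq hτ, mul_assoc, ← Real.exp_add, ← upperBranch_eq hτ, upperBranch, branchValue]
  ring_nf

theorem branchValue_pos {τ : ℝ} (hτ : 0 < τ) : 0 < branchValue τ :=
  mul_pos (lowerBranch_pos hτ) (Real.exp_pos _)

theorem branchValue_le_one (τ : ℝ) : branchValue τ ≤ 1 := by
  have h := Real.add_one_le_exp (lowerBranch τ - 1)
  calc branchValue τ ≤ Real.exp (lowerBranch τ - 1) * Real.exp (1 - lowerBranch τ) := by
        unfold branchValue
        gcongr
        linarith
    _ = 1 := by rw [← Real.exp_add]; simp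

theorem hasDerivAt_lowerBranch {τ : ℝ} (hτ : 0 < τ) :
    HasDerivAt lowerBranch (-(lowerBranch τ * (upperBranch τ - 1) / τ)) τ := by
  have h := (exp_sub_one_pos hτ).ne'
  refine ((hasDerivAt_id τ).div ((Real.hasDerivAt_exp τ).sub_const 1) h).congr_deriv ?_
  simp only [id, upperBranch, lowerBranch]
  field_simp
  ring

theorem hasDerivAt_upperBranch {τ : ℝ} (hτ : 0 < τ) :
    HasDerivAt upperBranch (upperBranch τ * (1 - lowerBranch τ) / τ) τ := by
  refine ((hasDerivAt_lowerBranch hτ).add (hasDerivAt_id τ)).congr_deriv ?_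
  simp only [upperBranch]
  field_simp
  ring

theorem hasDerivAt_branchValue {τ : ℝ} (hτ : 0 < τ) :
    HasDerivAt branchValue
      (-(branchValue τ * ((upperBranch τ - 1) * (1 - lowerBranch τ) / τ))) τ := by
  have hu := hasDerivAt_lowerBranch hτ
  refine (hu.mul (hu.const_sub 1).exp).congr_deriv ?_
  simp only [branchValue]
  ring

theorem tendsto_lowerBranch_atTop : Tendsto lowerBranch atTop (𝓝 0) := by
  have h : Tendsto (fun τ : ℝ => Real.exp τ / τ - τ⁻¹) atTop atTop := by
    have h1 : Tendsto (fun τ : ℝ => Real.exp τ / τ) atTop atTop := by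
      simpa using Real.tendsto_exp_div_pow_atTop 1
    simpa [sub_eq_add_neg] using h1.atTop_add (tendsto_inv_atTop_zero (𝕜 := ℝ)).neg
  refine h.inv_tendsto_atTop.congr' ?_
  filter_upwards with τ
  rw [Pi.inv_apply, lowerBranch, inv_eq_one_div τ, ← sub_div, inv_div]

theorem tendsto_upperBranch_atTop : Tendsto upperBranch atTop atTop :=
  tendsto_lowerBranch_atTop.add_atTop tendsto_id

theorem tendsto_branchValue_atTop : Tendsto branchValue atTop (𝓝 0) := by
  have h := tendsto_lowerBranch_atTop.mul
    ((Real.continuous_exp.tendsto _).comp (tendsto_lowerBranch_atTop.const_sub 1))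
  rwa [zero_mul] at h

theorem tendsto_lowerBranch_zero : Tendsto lowerBranch (𝓝[>] 0) (𝓝 1) := by
  have h : Tendsto (fun τ : ℝ => τ⁻¹ * (Real.exp τ - 1)) (𝓝[>] 0) (𝓝 1) := by
    have := (Real.hasDerivAt_exp 0).tendsto_slope_zero_right
    simpa using this
  have h2 := h.inv₀ one_ne_zero
  simp only [inv_one] at h2
  refine h2.congr fun τ => ?_
  rw [lowerBranch, mul_inv, inv_inv, div_eq_mul_inv]

theorem tendsto_upperBranch_zero : Tendsto upperBranch (𝓝[>] 0) (𝓝 1) := by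
  have h := tendsto_lowerBranch_zero.add
    ((tendsto_id (α := ℝ)).mono_left (nhdsWithin_le_nhds (s := Set.Ioi (0 : ℝ))))
  rwa [add_zero] at h

theorem tendsto_branchValue_zero : Tendsto branchValue (𝓝[>] 0) (𝓝 1) := by
  have h := tendsto_lowerBranch_zero.mul
    ((Real.continuous_exp.tendsto _).comp (tendsto_lowerBranch_zero.const_sub 1))
  rwa [sub_self, Real.exp_zero, one_mul] at h

/-! ### Symmetric sums over the branches and the density -/

/-- The sum of the reciprocals `1 / (1 - y)` over the two branches. -/
noncomputable def reciprocalSum (τ : ℝ) : ℝ := 1 / (1 - lowerBranch τ) - 1 / (upperBranch τ - 1)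

/-- The sum of `y / (y - 1) ^ 3` over the two branches. -/
noncomputable def cubicReciprocalSum (τ : ℝ) : ℝ :=
  upperBranch τ / (upperBranch τ - 1) ^ 3 - lowerBranch τ / (1 - lowerBranch τ) ^ 3

/-- The logarithmic derivative of `branchValue`, up to sign. -/
noncomputable def branchSpeed (τ : ℝ) : ℝ := (upperBranch τ - 1) * (1 - lowerBranch τ) / τ

theorem branchSpeed_pos {τ : ℝ} (hτ : 0 < τ) : 0 < branchSpeed τ :=
  div_pos (mul_pos (sub_pos.2 (one_lt_upperBranch hτ)) (sub_pos.2 (lowerBranch_lt_one hτ))) hτ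

/-- Half the sum of `y² (y - 4) / (y - 1)⁵` over the branches, times the speed. -/
noncomputable def branchDensity (τ : ℝ) : ℝ :=
  (upperBranch τ ^ 2 * (upperBranch τ - 4) / (upperBranch τ - 1) ^ 5 +
    lowerBranch τ ^ 2 * (4 - lowerBranch τ) / (1 - lowerBranch τ) ^ 5) / 2 * branchSpeed τ

theorem branchDensity_nonneg {τ : ℝ} (hτ : 0 < τ) : 0 ≤ branchDensity τ :=
  mul_nonneg (div_nonneg (branch_sum_nonneg (lowerBranch_pos hτ) (lowerBranch_lt_one hτ)
    (one_lt_upperBranch hτ) (sub_log_branch_eq hτ)) two_pos.le) (branchSpeed_pos hτ).le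

/-- Since -log x has τ-derivative `branchSpeed`, this says C = -x dR/dx, the first integration by
parts. -/
theorem hasDerivAt_reciprocalSum {τ : ℝ} (hτ : 0 < τ) :
    HasDerivAt reciprocalSum (branchSpeed τ * cubicReciprocalSum τ) τ := by
  have hu1 : 1 - lowerBranch τ ≠ 0 := (sub_pos.2 (lowerBranch_lt_one hτ)).ne'
  have hv1 : upperBranch τ - 1 ≠ 0 := (sub_pos.2 (one_lt_upperBranch hτ)).ne'
  refine (((hasDerivAt_const τ (1 : ℝ)).div ((hasDerivAt_lowerBranch hτ).const_sub 1) hu1).sub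
    ((hasDerivAt_const τ (1 : ℝ)).div ((hasDerivAt_upperBranch hτ).sub_const 1) hv1)).congr_deriv ?_
  unfold branchSpeed cubicReciprocalSum
  field_simp
  ring

theorem hasDerivAt_cubicReciprocalSum {τ : ℝ} (hτ : 0 < τ) :
    HasDerivAt cubicReciprocalSum
      (-(branchSpeed τ * (upperBranch τ * (1 + 2 * upperBranch τ) / (upperBranch τ - 1) ^ 5 -
        lowerBranch τ * (1 + 2 * lowerBranch τ) / (1 - lowerBranch τ) ^ 5))) τ := by
  have hu1 : 1 - lowerBranch τ ≠ 0 := (sub_pos.2 (lowerBranch_lt_one hτ)).ne'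
  have hv1 : upperBranch τ - 1 ≠ 0 := (sub_pos.2 (one_lt_upperBranch hτ)).ne'
  have hu := hasDerivAt_lowerBranch hτ
  have hv := hasDerivAt_upperBranch hτ
  refine ((hv.div ((hv.sub_const 1).pow 3) (pow_ne_zero 3 hv1)).sub
    (hu.div ((hu.const_sub 1).pow 3) (pow_ne_zero 3 hu1))).congr_deriv ?_
  unfold branchSpeed
  simp only [Pi.pow_apply]
  field_simp
  ring

/-! ### Limits of the symmetric sums as the branches merge, τ → 0 -/

/-- The fourth-order Taylor remainder of the exponential, divided by `τ ^ 5`. -/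
noncomputable def expRemainder (τ : ℝ) : ℝ :=
  (Real.exp τ - (1 + τ + τ ^ 2 / 2 + τ ^ 3 / 6 + τ ^ 4 / 24)) / τ ^ 5

theorem tendsto_expRemainder : Tendsto expRemainder (𝓝[≠] 0) (𝓝 (1 / 120)) := by
  have h := ((Real.exp_sub_sum_range_succ_isLittleO_pow 5).mono
    (nhdsWithin_le_nhds (s := {(0 : ℝ)}ᶜ))).tendsto_div_nhds_zero.add_const (1 / 120)
  rw [zero_add] at h
  refine h.congr' ?_
  filter_upwards [self_mem_nhdsWithin] with τ hτ
  have hτ0 : τ ≠ 0 := hτ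
  simp only [expRemainder, Finset.sum_range_succ, Finset.sum_range_zero, Nat.factorial]
  field_simp
  push_cast
  ring

theorem tendsto_expRemainder_neg :
    Tendsto (fun τ => expRemainder (-τ)) (𝓝[≠] 0) (𝓝 (1 / 120)) := by
  refine tendsto_expRemainder.comp (tendsto_nhdsWithin_iff.2 ⟨?_, ?_⟩)
  · have : Tendsto (fun τ : ℝ => -τ) (𝓝 0) (𝓝 0) := by simpa using (continuous_neg (G := ℝ)).tendsto 0
    exact this.mono_left nhdsWithin_le_nhds
  · filter_upwards [self_mem_nhdsWithin] with τ hτ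
    simpa using hτ

/-- The normalised second-order remainder of `2 cosh`. -/
noncomputable def coshRemainder (τ : ℝ) : ℝ :=
  1 / 12 + τ * (expRemainder τ - expRemainder (-τ))

/-- The normalised third-order remainder of `2 sinh`. -/
noncomputable def sinhRemainder (τ : ℝ) : ℝ := expRemainder τ + expRemainder (-τ)

theorem tendsto_id_punctured : Tendsto (fun τ : ℝ => τ) (𝓝[≠] 0) (𝓝 0) :=
  tendsto_id.mono_left nhdsWithin_le_nhds

theorem tendsto_coshRemainder : Tendsto coshRemainder (𝓝[≠] 0) (𝓝 (1 / 12)) := by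
  have h := (tendsto_id_punctured.mul
    (tendsto_expRemainder.sub tendsto_expRemainder_neg)).const_add (1 / 12)
  rwa [zero_mul, add_zero] at h

theorem tendsto_sinhRemainder : Tendsto sinhRemainder (𝓝[≠] 0) (𝓝 (1 / 60)) := by
  have h := tendsto_expRemainder.add tendsto_expRemainder_neg
  rwa [show (1 : ℝ) / 120 + 1 / 120 = 1 / 60 by norm_num] at h

/-- Even and odd parts are separated: the inner brackets are 2(cosh τ - 1)/τ² and 2(sinh τ - τ)/τ³.
The poles of the symmetric sums at τ = 0 then cancel algebraically. -/
theorem exp_eq_remainders {τ : ℝ} (hτ : τ ≠ 0) :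
    Real.exp τ = 1 + τ + τ ^ 2 * ((1 + τ ^ 2 * coshRemainder τ) +
      τ * (1 / 3 + τ ^ 2 * sinhRemainder τ)) / 2 := by
  unfold coshRemainder sinhRemainder expRemainder
  field_simp
  ring

theorem exp_neg_eq_remainders {τ : ℝ} (hτ : τ ≠ 0) :
    Real.exp (-τ) = 1 - τ + τ ^ 2 * ((1 + τ ^ 2 * coshRemainder τ) -
      τ * (1 / 3 + τ ^ 2 * sinhRemainder τ)) / 2 := by
  unfold coshRemainder sinhRemainder expRemainder
  field_simp
  ring

/-- Rational expression of `reciprocalSum` in the normalised hyperbolic functions. -/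
noncomputable def reciprocalExpansion (τ s d : ℝ) : ℝ :=
  2 - 4 * d / (s ^ 2 - τ ^ 2 * d ^ 2)

/-- Rational expression of `cubicReciprocalSum` in the normalised hyperbolic functions. -/
noncomputable def cubicExpansion (τ s d p q : ℝ) : ℝ :=
  ((s ^ 2 * (3 * q - 2 * p - τ ^ 2 * p ^ 2) + d ^ 3 + τ ^ 2 * d ^ 4) / 4 +
    ((s ^ 2 - τ ^ 2 * d ^ 2) / 4) ^ 2 * d) / ((s ^ 2 - τ ^ 2 * d ^ 2) / 4) ^ 3

section

variable {τ A B : ℝ}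

theorem lowerBranch_eq_of_exp (hτ : 0 < τ) (hA : Real.exp τ = 1 + τ + τ ^ 2 * A) :
    lowerBranch τ = 1 / (1 + τ * A) := by
  have := exp_sub_one_pos hτ
  rw [hA] at this
  have h : 1 + τ * A ≠ 0 := by
    intro h
    nlinarith
  rw [lowerBranch, hA, div_eq_div_iff this.ne' h]
  ring

theorem upperBranch_eq_of_exp (hτ : 0 < τ) (hB : Real.exp (-τ) = 1 - τ + τ ^ 2 * B) :
    upperBranch τ = 1 / (1 - τ * B) := by
  have : 0 < 1 - Real.exp (-τ) := by
    have := Real.exp_lt_one_iff.2 (neg_neg_of_pos hτ)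
    linarith
  rw [hB] at this
  have h : 1 - τ * B ≠ 0 := by
    intro h
    nlinarith
  rw [upperBranch_eq_div hτ, hB, div_eq_div_iff this.ne' h]
  ring

theorem exp_quadratic_coeff_pos (hτ : 0 < τ) (hA : Real.exp τ = 1 + τ + τ ^ 2 * A) : 0 < A := by
  have := Real.add_one_lt_exp hτ.ne'
  by_contra! h
  nlinarith [mul_nonneg (sq_nonneg τ) (neg_nonneg.2 h)]

theorem exp_neg_quadratic_coeff_pos (hτ : 0 < τ) (hB : Real.exp (-τ) = 1 - τ + τ ^ 2 * B) :
    0 < B := by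
  have := Real.add_one_lt_exp (neg_ne_zero.2 hτ.ne')
  by_contra! h
  nlinarith [mul_nonneg (sq_nonneg τ) (neg_nonneg.2 h)]

theorem reciprocalSum_eq_of_exp (hτ : 0 < τ) (hA : Real.exp τ = 1 + τ + τ ^ 2 * A)
    (hB : Real.exp (-τ) = 1 - τ + τ ^ 2 * B) :
    reciprocalSum τ = (1 + τ * A) / (τ * A) - (1 - τ * B) / (τ * B) := by
  have hu := lowerBranch_pos hτ
  have hv := (one_lt_upperBranch hτ).trans' one_pos
  have hu1 := sub_pos.2 (lowerBranch_lt_one hτ)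
  have hv1 := sub_pos.2 (one_lt_upperBranch hτ)
  have ea : 1 + τ * A = 1 / lowerBranch τ := by rw [lowerBranch_eq_of_exp hτ hA, one_div_one_div]
  have eb : 1 - τ * B = 1 / upperBranch τ := by rw [upperBranch_eq_of_exp hτ hB, one_div_one_div]
  have ea' : τ * A = (1 - lowerBranch τ) / lowerBranch τ := by
    rw [sub_div, div_self hu.ne']; linarith
  have eb' : τ * B = (upperBranch τ - 1) / upperBranch τ := by
    rw [sub_div, div_self hv.ne']; linarith
  rw [ea, eb, ea', eb', reciprocalSum]
  field_simp

theorem cubicReciprocalSum_eq_of_exp (hτ : 0 < τ) (hA : Real.exp τ = 1 + τ + τ ^ 2 * A)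
    (hB : Real.exp (-τ) = 1 - τ + τ ^ 2 * B) :
    cubicReciprocalSum τ = (1 - τ * B) ^ 2 / (τ * B) ^ 3 - (1 + τ * A) ^ 2 / (τ * A) ^ 3 := by
  have hu := lowerBranch_pos hτ
  have hv := (one_lt_upperBranch hτ).trans' one_pos
  have hu1 := sub_pos.2 (lowerBranch_lt_one hτ)
  have hv1 := sub_pos.2 (one_lt_upperBranch hτ)
  have ea : 1 + τ * A = 1 / lowerBranch τ := by rw [lowerBranch_eq_of_exp hτ hA, one_div_one_div]
  have eb : 1 - τ * B = 1 / upperBranch τ := by rw [upperBranch_eq_of_exp hτ hB, one_div_one_div]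
  have ea' : τ * A = (1 - lowerBranch τ) / lowerBranch τ := by
    rw [sub_div, div_self hu.ne']; linarith
  have eb' : τ * B = (upperBranch τ - 1) / upperBranch τ := by
    rw [sub_div, div_self hv.ne']; linarith
  rw [ea, eb, ea', eb', cubicReciprocalSum]
  field_simp

end

theorem reciprocalSum_eq_expansion {τ : ℝ} (hτ : 0 < τ) :
    reciprocalSum τ = reciprocalExpansion τ (1 + τ ^ 2 * coshRemainder τ)
      (1 / 3 + τ ^ 2 * sinhRemainder τ) := by
  have hA := exp_eq_remainders hτ.ne'
  have hB := exp_neg_eq_remainders hτ.ne'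
  generalize 1 + τ ^ 2 * coshRemainder τ = s at *
  generalize 1 / 3 + τ ^ 2 * sinhRemainder τ = d at *
  rw [mul_div_assoc] at hA hB
  have hA0 := exp_quadratic_coeff_pos hτ hA
  have hB0 := exp_neg_quadratic_coeff_pos hτ hB
  rw [reciprocalSum_eq_of_exp hτ hA hB, reciprocalExpansion,
    show s ^ 2 - τ ^ 2 * d ^ 2 = 4 * ((s + τ * d) / 2) * ((s - τ * d) / 2) by ring]
  obtain ⟨A, hAe⟩ : ∃ A, A = (s + τ * d) / 2 := ⟨_, rfl⟩
  obtain ⟨B, hBe⟩ : ∃ B, B = (s - τ * d) / 2 := ⟨_, rfl⟩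
  rw [← hAe] at hA0 ⊢
  rw [← hBe] at hB0 ⊢
  have hd : d = (A - B) / τ := by rw [hAe, hBe]; field_simp; ring
  rw [hd]
  field_simp
  ring

theorem cubicReciprocalSum_eq_expansion {τ : ℝ} (hτ : 0 < τ) :
    cubicReciprocalSum τ = cubicExpansion τ (1 + τ ^ 2 * coshRemainder τ)
      (1 / 3 + τ ^ 2 * sinhRemainder τ) (coshRemainder τ) (sinhRemainder τ) := by
  have hA := exp_eq_remainders hτ.ne'
  have hB := exp_neg_eq_remainders hτ.ne'
  generalize coshRemainder τ = p at *
  generalize sinhRemainder τ = q at *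
  obtain ⟨s, hs⟩ : ∃ s, s = 1 + τ ^ 2 * p := ⟨_, rfl⟩
  obtain ⟨d, hd⟩ : ∃ d, d = 1 / 3 + τ ^ 2 * q := ⟨_, rfl⟩
  rw [← hs, ← hd] at hA hB ⊢
  -- The cancellation behind the finite limit: 3d - s² is divisible by τ², as both 3d and s² start
  -- with 1.
  have hr : 3 * q - 2 * p - τ ^ 2 * p ^ 2 = (3 * d - s ^ 2) / τ ^ 2 := by
    rw [hs, hd]; field_simp; ring
  rw [mul_div_assoc] at hA hB
  have hA0 := exp_quadratic_coeff_pos hτ hA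
  have hB0 := exp_neg_quadratic_coeff_pos hτ hB
  rw [cubicReciprocalSum_eq_of_exp hτ hA hB, cubicExpansion, hr,
    show (s ^ 2 - τ ^ 2 * d ^ 2) / 4 = ((s + τ * d) / 2) * ((s - τ * d) / 2) by ring]
  obtain ⟨A, hAe⟩ : ∃ A, A = (s + τ * d) / 2 := ⟨_, rfl⟩
  obtain ⟨B, hBe⟩ : ∃ B, B = (s - τ * d) / 2 := ⟨_, rfl⟩
  rw [← hAe] at hA0 ⊢
  rw [← hBe] at hB0 ⊢
  have hd' : d = (A - B) / τ := by rw [hAe, hBe]; field_simp; ring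
  have hs' : s = A + B := by rw [hAe, hBe]; ring
  rw [hd', hs']
  field_simp
  ring

theorem tendsto_one_add_sq_mul_coshRemainder :
    Tendsto (fun τ => 1 + τ ^ 2 * coshRemainder τ) (𝓝[≠] 0) (𝓝 1) := by
  have h := ((tendsto_id_punctured.pow 2).mul tendsto_coshRemainder).const_add 1
  convert h using 2
  norm_num

theorem tendsto_third_add_sq_mul_sinhRemainder :
    Tendsto (fun τ => 1 / 3 + τ ^ 2 * sinhRemainder τ) (𝓝[≠] 0) (𝓝 (1 / 3)) := by
  have h := ((tendsto_id_punctured.pow 2).mul tendsto_sinhRemainder).const_add (1 / 3)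
  convert h using 2
  norm_num

theorem tendsto_reciprocalSum_zero : Tendsto reciprocalSum (𝓝[>] 0) (𝓝 (2 / 3)) := by
  have hs := tendsto_one_add_sq_mul_coshRemainder
  have hd := tendsto_third_add_sq_mul_sinhRemainder
  have h := ((hd.const_mul 4).div ((hs.pow 2).sub ((tendsto_id_punctured.pow 2).mul (hd.pow 2)))
    (by norm_num)).const_sub 2
  have h2 := h.mono_left (nhdsGT_le_nhdsNE (0 : ℝ))
  rw [show (2 : ℝ) - 4 * (1 / 3) / (1 ^ 2 - 0 ^ 2 * (1 / 3) ^ 2) = 2 / 3 by norm_num] at h2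
  refine h2.congr' ?_
  filter_upwards [self_mem_nhdsWithin] with τ hτ
  exact (reciprocalSum_eq_expansion hτ).symm

theorem tendsto_cubicReciprocalSum_zero :
    Tendsto cubicReciprocalSum (𝓝[>] 0) (𝓝 (8 / 135)) := by
  have hs := tendsto_one_add_sq_mul_coshRemainder
  have hd := tendsto_third_add_sq_mul_sinhRemainder
  have hp := tendsto_coshRemainder
  have hq := tendsto_sinhRemainder
  have ht := tendsto_id_punctured.pow 2
  have hm := ((hs.pow 2).sub (ht.mul (hd.pow 2))).div_const 4
  have h := (((((hs.pow 2).mul (((hq.const_mul 3).sub (hp.const_mul 2)).sub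
    (ht.mul (hp.pow 2)))).add (hd.pow 3)).add (ht.mul (hd.pow 4))).div_const 4).add
    ((hm.pow 2).mul hd)
  have h2 := (h.div (hm.pow 3) (by norm_num)).mono_left (nhdsGT_le_nhdsNE (0 : ℝ))
  norm_num only at h2
  refine h2.congr' ?_
  filter_upwards [self_mem_nhdsWithin] with τ hτ
  rw [cubicReciprocalSum_eq_expansion hτ, cubicExpansion, Pi.div_apply]

/-! ### Erlang tails and the integral form of θ -/

/-- The tail of the Erlang distribution of order `n`, namely `exp (-t) * ∑_{k < n} t ^ k / k!`. -/
noncomputable def erlangTail (n : ℕ) (t : ℝ) : ℝ :=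
  Real.exp (-t) * ∑ k ∈ Finset.range n, t ^ k / (Nat.factorial k : ℝ)

theorem erlangTail_succ (n : ℕ) (t : ℝ) :
    erlangTail (n + 1) t = erlangTail n t + Real.exp (-t) * (t ^ n / (Nat.factorial n : ℝ)) := by
  rw [erlangTail, Finset.sum_range_succ, mul_add, erlangTail]

/-- Differentiating the partial sum telescopes, leaving only the top term. -/
theorem hasDerivAt_erlangTail_succ (n : ℕ) (t : ℝ) :
    HasDerivAt (erlangTail (n + 1)) (-(Real.exp (-t) * (t ^ n / (Nat.factorial n : ℝ)))) t := by
  have he : HasDerivAt (fun t : ℝ => Real.exp (-t)) (-Real.exp (-t)) t := by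
    simpa using (hasDerivAt_neg t).exp
  induction n with
  | zero =>
    have h : erlangTail (0 + 1) = fun t => Real.exp (-t) := by
      funext t
      simp [erlangTail]
    rw [h]
    simpa using he
  | succ n ih =>
    have h := ih.add (he.mul (((hasDerivAt_id t).pow (n + 1)).div_const
      (Nat.factorial (n + 1) : ℝ)))
    refine (h.congr_of_eventuallyEq (.of_forall fun s => ?_)).congr_deriv ?_
    · rw [erlangTail_succ (n + 1)]
      rfl
    · have hf : (Nat.factorial n : ℝ) ≠ 0 := by positivity
      simp only [id, Pi.pow_apply, Nat.factorial_succ, Nat.cast_mul, Nat.cast_add, Nat.cast_one,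
        Nat.add_sub_cancel]
      field_simp
      ring

theorem continuous_erlangTail (n : ℕ) : Continuous (erlangTail n) := by
  unfold erlangTail
  fun_prop

theorem erlangTail_zero_right (n : ℕ) : erlangTail n 0 = 1 - 0 ^ n := by
  cases n with
  | zero => simp [erlangTail]
  | succ n => simp [erlangTail, Finset.sum_range_succ']

theorem tendsto_erlangTail_atTop (n : ℕ) : Tendsto (erlangTail n) atTop (𝓝 0) := by
  induction n with
  | zero =>
    have h : erlangTail 0 = fun _ => 0 := by
      funext t
      simp [erlangTail]
    rw [h]
    exact tendsto_const_nhds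
  | succ n ih =>
    have h := ih.add
      ((Real.tendsto_pow_mul_exp_neg_atTop_nhds_zero n).div_const (Nat.factorial n : ℝ))
    rw [zero_div, add_zero] at h
    refine h.congr fun t => ?_
    rw [erlangTail_succ]
    ring

/-- The factor `exp n * n! / (2 * n ^ n)`. -/
noncomputable def stirlingFactor (n : ℕ) : ℝ :=
  Real.exp n * Nat.factorial n / (2 * (n : ℝ) ^ n)

theorem ramanujanTheta_eq (n : ℕ) :
    ramanujanTheta n = stirlingFactor n * (1 - 2 * erlangTail n n) := by
  rcases Nat.eq_zero_or_pos n with rfl | hn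
  · simp [ramanujanTheta, stirlingFactor, erlangTail]
  · have hn' : (n : ℝ) ≠ 0 := by positivity
    rw [ramanujanTheta, if_neg hn.ne', stirlingFactor, erlangTail, Real.exp_neg]
    field_simp

theorem hasDerivAt_stirlingFactor_mul_erlangTail (n : ℕ) {y : ℝ} (hy : 0 < y) :
    HasDerivAt (fun y => stirlingFactor n * erlangTail n (n * y))
      (-(n / 2 * (y * Real.exp (1 - y)) ^ n / y)) y := by
  cases n with
  | zero => simpa [erlangTail] using hasDerivAt_const y (0 : ℝ)
  | succ n =>
    have h := ((hasDerivAt_erlangTail_succ n (((n + 1 : ℕ) : ℝ) * y)).comp y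
      ((hasDerivAt_id y).const_mul (((n + 1 : ℕ) : ℝ)))).const_mul (stirlingFactor (n + 1))
    refine h.congr_deriv ?_
    have hn : ((n + 1 : ℕ) : ℝ) ≠ 0 := by positivity
    have hf : (Nat.factorial n : ℝ) ≠ 0 := by positivity
    have he : Real.exp (1 - y) ^ (n + 1) =
        Real.exp ((n + 1 : ℕ) : ℝ) * Real.exp (-(((n + 1 : ℕ) : ℝ) * y)) := by
      rw [← Real.exp_nat_mul, ← Real.exp_add]
      ring_nf
    rw [mul_pow y, he, stirlingFactor, Nat.factorial_succ, Nat.cast_mul]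
    generalize Real.exp ((n + 1 : ℕ) : ℝ) = e₁
    generalize Real.exp (-(((n + 1 : ℕ) : ℝ) * y)) = e₂
    generalize ((n + 1 : ℕ) : ℝ) = N at *
    field_simp
    ring

/-! ### The moment primitive and its boundary values -/

/-- A primitive of `branchValue ^ n * branchDensity`. -/
noncomputable def momentPrimitive (n : ℕ) (τ : ℝ) : ℝ :=
  (n + 1) * (stirlingFactor n * erlangTail n (n * lowerBranch τ) +
    stirlingFactor n * erlangTail n (n * upperBranch τ) +
    branchValue τ ^ n * reciprocalSum τ / 2) + branchValue τ ^ n * cubicReciprocalSum τ / 2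

theorem hasDerivAt_momentPrimitive (n : ℕ) {τ : ℝ} (hτ : 0 < τ) :
    HasDerivAt (momentPrimitive n) (branchValue τ ^ n * branchDensity τ) τ := by
  have hu0 := lowerBranch_pos hτ
  have hv0 := (one_lt_upperBranch hτ).trans' one_pos
  have hu := (hasDerivAt_stirlingFactor_mul_erlangTail n hu0).comp τ (hasDerivAt_lowerBranch hτ)
  have hv := (hasDerivAt_stirlingFactor_mul_erlangTail n hv0).comp τ (hasDerivAt_upperBranch hτ)
  have hx : HasDerivAt (fun τ => branchValue τ ^ n)
      (-(n * branchValue τ ^ n * branchSpeed τ)) τ := by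
    refine ((hasDerivAt_branchValue hτ).pow n).congr_deriv ?_
    rw [← branchSpeed]
    cases n with
    | zero => simp
    | succ n =>
      simp only [Nat.add_sub_cancel]
      ring
  have h := (((hu.add hv).add ((hx.mul (hasDerivAt_reciprocalSum hτ)).div_const 2)).const_mul
    ((n : ℝ) + 1)).add ((hx.mul (hasDerivAt_cubicReciprocalSum hτ)).div_const 2)
  refine h.congr_deriv ?_
  rw [← branchValue_eq_upper hτ, ← branchValue, branchDensity]
  have hu1 : 1 - lowerBranch τ ≠ 0 := (sub_pos.2 (lowerBranch_lt_one hτ)).ne'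
  have hv1 : upperBranch τ - 1 ≠ 0 := (sub_pos.2 (one_lt_upperBranch hτ)).ne'
  -- The two Erlang terms combine into (n/2) x^n R times the speed, which cancels the derivative of
  -- x^n in the term x^n R / 2.
  have e1 : -(n / 2 * branchValue τ ^ n / lowerBranch τ) *
      -(lowerBranch τ * (upperBranch τ - 1) / τ) +
      -(n / 2 * branchValue τ ^ n / upperBranch τ) * (upperBranch τ * (1 - lowerBranch τ) / τ) =
      n / 2 * branchValue τ ^ n * branchSpeed τ * reciprocalSum τ := by
    unfold branchSpeed reciprocalSum
    field_simp
    ring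
  rw [e1]
  -- This identifies the density sum with C - x C': the extra C comes from the 1 in the factor n +
  -- 1.
  have e2 : upperBranch τ ^ 2 * (upperBranch τ - 4) / (upperBranch τ - 1) ^ 5 +
      lowerBranch τ ^ 2 * (4 - lowerBranch τ) / (1 - lowerBranch τ) ^ 5 =
      cubicReciprocalSum τ - (upperBranch τ * (1 + 2 * upperBranch τ) / (upperBranch τ - 1) ^ 5 -
        lowerBranch τ * (1 + 2 * lowerBranch τ) / (1 - lowerBranch τ) ^ 5) := by
    unfold cubicReciprocalSum
    field_simp
    ring
  rw [e2]
  ring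

theorem tendsto_inv_upperBranch_sub_one :
    Tendsto (fun τ => (upperBranch τ - 1)⁻¹) atTop (𝓝 0) :=
  tendsto_inv_atTop_zero.comp (tendsto_atTop_add_const_right _ (-1) tendsto_upperBranch_atTop)

theorem tendsto_inv_one_sub_lowerBranch :
    Tendsto (fun τ => (1 - lowerBranch τ)⁻¹) atTop (𝓝 1) := by
  simpa using (tendsto_lowerBranch_atTop.const_sub 1).inv₀ (by norm_num)

theorem tendsto_reciprocalSum_atTop : Tendsto reciprocalSum atTop (𝓝 1) := by
  have h := tendsto_inv_one_sub_lowerBranch.sub tendsto_inv_upperBranch_sub_one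
  rw [sub_zero] at h
  refine h.congr fun τ => ?_
  rw [reciprocalSum, one_div, one_div]

theorem tendsto_cubicReciprocalSum_atTop : Tendsto cubicReciprocalSum atTop (𝓝 0) := by
  have h := ((tendsto_inv_upperBranch_sub_one.pow 2).add
    (tendsto_inv_upperBranch_sub_one.pow 3)).sub
    (tendsto_lowerBranch_atTop.mul (tendsto_inv_one_sub_lowerBranch.pow 3))
  rw [show (0 : ℝ) ^ 2 + 0 ^ 3 - 0 * 1 ^ 3 = 0 by norm_num] at h
  refine h.congr' ?_
  filter_upwards [eventually_gt_atTop 0] with τ hτ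
  have hu1 : 1 - lowerBranch τ ≠ 0 := (sub_pos.2 (lowerBranch_lt_one hτ)).ne'
  have hv1 : upperBranch τ - 1 ≠ 0 := (sub_pos.2 (one_lt_upperBranch hτ)).ne'
  rw [cubicReciprocalSum]
  field_simp
  ring

theorem tendsto_momentPrimitive_atTop (n : ℕ) :
    Tendsto (momentPrimitive n) atTop (𝓝 ((n + 1) * stirlingFactor n)) := by
  have hP := (continuous_erlangTail n).tendsto ((n : ℝ) * 0)
  have hu := (hP.comp (tendsto_lowerBranch_atTop.const_mul (n : ℝ))).const_mul (stirlingFactor n)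
  have hv : Tendsto (fun τ => stirlingFactor n * erlangTail n (n * upperBranch τ)) atTop
      (𝓝 0) := by
    rcases Nat.eq_zero_or_pos n with rfl | hn
    · simp [erlangTail]
    · have h := ((tendsto_erlangTail_atTop n).comp (tendsto_upperBranch_atTop.const_mul_atTop
        (Nat.cast_pos.2 hn))).const_mul (stirlingFactor n)
      rwa [mul_zero] at h
  have hx := tendsto_branchValue_atTop.pow n
  have h := (((hu.add hv).add ((hx.mul tendsto_reciprocalSum_atTop).div_const 2)).const_mul
    ((n : ℝ) + 1)).add ((hx.mul tendsto_cubicReciprocalSum_atTop).div_const 2)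
  refine (h.congr fun τ => ?_).trans_eq ?_
  · rfl
  · rw [mul_zero, erlangTail_zero_right]
    -- For n = 0 the Erlang term vanishes and the limit 1/2 comes from R/2, since x^0 = 1; for n ≥ 1
    -- the roles are exchanged. Both agree with `stirlingFactor n`.
    rcases Nat.eq_zero_or_pos n with rfl | hn
    · norm_num [stirlingFactor]
    · simp [hn.ne']

theorem tendsto_momentPrimitive_zero (n : ℕ) :
    Tendsto (momentPrimitive n) (𝓝[>] 0)
      (𝓝 ((n + 1) * (2 * stirlingFactor n * erlangTail n n + 1 / 3) + 4 / 135)) := by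
  have hP := (continuous_erlangTail n).tendsto ((n : ℝ) * 1)
  have hu := (hP.comp (tendsto_lowerBranch_zero.const_mul (n : ℝ))).const_mul (stirlingFactor n)
  have hv := (hP.comp (tendsto_upperBranch_zero.const_mul (n : ℝ))).const_mul (stirlingFactor n)
  have hx := tendsto_branchValue_zero.pow n
  have h := (((hu.add hv).add ((hx.mul tendsto_reciprocalSum_zero).div_const 2)).const_mul
    ((n : ℝ) + 1)).add ((hx.mul tendsto_cubicReciprocalSum_zero).div_const 2)
  refine (h.congr fun τ => ?_).trans_eq ?_
  · rfl
  · rw [mul_one, one_pow]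
    ring_nf

/-- Nonnegativity of the integrand gives integrability from the existence of the two boundary limits
alone. -/
theorem moment_integrable_and_integral (n : ℕ) :
    IntegrableOn (fun τ => branchValue τ ^ n * branchDensity τ) (Set.Ioi 0) ∧
      ∫ τ in Set.Ioi 0, branchValue τ ^ n * branchDensity τ =
        (n + 1) * (ramanujanTheta n - 1 / 3) - 4 / 135 := by
  set l : ℝ := (n + 1) * (2 * stirlingFactor n * erlangTail n n + 1 / 3) + 4 / 135
  -- At τ = 0 the branch formulas divide by zero, so the primitive is redefined there by its limit.
  have hcont : ContinuousWithinAt (Function.update (momentPrimitive n) 0 l) (Set.Ici 0) 0 := by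
    rw [continuousWithinAt_update_same, Set.Ici_sdiff_left]
    exact tendsto_momentPrimitive_zero n
  have hderiv : ∀ τ ∈ Set.Ioi (0 : ℝ), HasDerivAt (Function.update (momentPrimitive n) 0 l)
      (branchValue τ ^ n * branchDensity τ) τ := fun τ hτ =>
    (hasDerivAt_momentPrimitive n hτ).congr_of_eventuallyEq <| by
      filter_upwards [Ioi_mem_nhds hτ] with s hs
      exact Function.update_of_ne (ne_of_gt hs) _ _
  have hnonneg : ∀ τ ∈ Set.Ioi (0 : ℝ), 0 ≤ branchValue τ ^ n * branchDensity τ := fun τ hτ =>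
    mul_nonneg (pow_nonneg (branchValue_pos hτ).le n) (branchDensity_nonneg hτ)
  have hlim : Tendsto (Function.update (momentPrimitive n) 0 l) atTop
      (𝓝 ((n + 1) * stirlingFactor n)) := by
    refine (tendsto_momentPrimitive_atTop n).congr' ?_
    filter_upwards [eventually_gt_atTop 0] with s hs
    exact (Function.update_of_ne (ne_of_gt hs) _ _).symm
  refine ⟨integrableOn_Ioi_deriv_of_nonneg hcont hderiv hnonneg hlim, ?_⟩
  rw [integral_Ioi_of_hasDerivAt_of_nonneg hcont hderiv hnonneg hlim, Function.update_self,
    ramanujanTheta_eq]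
  ring

/-! ### The representing probability measure -/

theorem measurable_lowerBranch : Measurable lowerBranch := by
  unfold lowerBranch
  fun_prop

theorem measurable_upperBranch : Measurable upperBranch :=
  measurable_lowerBranch.add measurable_id

theorem measurable_branchValue : Measurable branchValue :=
  measurable_lowerBranch.mul (measurable_lowerBranch.const_sub 1).exp

theorem measurable_branchDensity : Measurable branchDensity := by
  have hu := measurable_lowerBranch
  have hv := measurable_upperBranch
  unfold branchDensity branchSpeed
  fun_prop

/-- The law on `[0, 1]` of `branchValue` under the normalised density `branchDensity`. -/
noncomputable def ramanujanMeasure : Measure ℝ :=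
  (((volume : Measure ℝ).restrict (Set.Ioi 0)).withDensity
    fun τ => ENNReal.ofReal (270 / 37 * branchDensity τ)).map branchValue

theorem integral_pow_ramanujanMeasure (n : ℕ) :
    ∫ x, x ^ n ∂ramanujanMeasure =
      270 / 37 * ((n + 1) * (ramanujanTheta n - 1 / 3) - 4 / 135) := by
  rw [ramanujanMeasure, integral_map measurable_branchValue.aemeasurable (by fun_prop),
    integral_withDensity_eq_integral_toReal_smul
      (measurable_branchDensity.const_mul _).ennreal_ofReal (by simp),
    ← (moment_integrable_and_integral n).2, ← integral_const_mul]
  refine setIntegral_congr_fun measurableSet_Ioi fun τ hτ => ?_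
  have h : 0 ≤ 270 / 37 * branchDensity τ := mul_nonneg (by norm_num) (branchDensity_nonneg hτ)
  simp only [ENNReal.toReal_ofReal h, smul_eq_mul]
  ring

instance isProbabilityMeasure_ramanujanMeasure : IsProbabilityMeasure ramanujanMeasure := by
  refine ⟨?_⟩
  have hI := moment_integrable_and_integral 0
  simp only [pow_zero, one_mul] at hI
  rw [ramanujanMeasure, Measure.map_apply measurable_branchValue MeasurableSet.univ,
    Set.preimage_univ, withDensity_apply _ MeasurableSet.univ, Measure.restrict_univ,
    ← ofReal_integral_eq_lintegral_ofReal (hI.1.const_mul _), integral_const_mul, hI.2]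
  -- The zeroth moment is θ_0 - 1/3 - 4/135 = 37/270, whence the normalisation 270/37.
  · norm_num [ramanujanTheta]
  · filter_upwards [ae_restrict_mem measurableSet_Ioi] with τ hτ
    exact mul_nonneg (by norm_num) (branchDensity_nonneg hτ)

theorem ae_mem_Icc_ramanujanMeasure : ∀ᵐ x ∂ramanujanMeasure, x ∈ Set.Icc (0 : ℝ) 1 := by
  refine (ae_map_iff measurable_branchValue.aemeasurable measurableSet_Icc).2 ?_
  refine (withDensity_absolutelyContinuous _ _).ae_le ?_
  filter_upwards [ae_restrict_mem measurableSet_Ioi] with τ hτ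
  exact ⟨(branchValue_pos hτ).le, branchValue_le_one τ⟩

/-! ### Distribution function and complete monotonicity -/

/-- The distribution function of a probability measure carried by `[0, 1]`. -/
theorem isProbDistributionOnUnitInterval_cdf {μ : Measure ℝ} [IsProbabilityMeasure μ]
    (hμ : ∀ᵐ x ∂μ, x ∈ Set.Icc (0 : ℝ) 1) :
    IsProbDistributionOnUnitInterval (ProbabilityTheory.cdf μ) where
  eq_zero x hx := by
    rw [ProbabilityTheory.cdf_eq_real, measureReal_eq_zero_iff]
    exact measure_mono_null (t := {y | y ∉ Set.Icc (0 : ℝ) 1})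
      (fun y hy hy' => absurd (hy'.1.trans hy) (not_le.2 hx)) hμ
  eq_one x hx := by
    rw [ProbabilityTheory.cdf_eq_real, measureReal_def,
      (prob_compl_eq_zero_iff measurableSet_Iic).1, ENNReal.toReal_one]
    exact measure_mono_null (t := {y | y ∉ Set.Icc (0 : ℝ) 1})
      (fun y hy hy' => hy (hy'.2.trans hx)) hμ

/-- A constant plus a nonnegative multiple of a moment sequence is completely monotone. -/
theorem completelyMonotoneSeq_of_moments {μ : Measure ℝ} [IsFiniteMeasureOnCompacts μ] {a : ℕ → ℝ}
    {b c : ℝ} (hb : 0 ≤ b) (hc : 0 ≤ c)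
    (ha : ∀ n, a n = b + c * ∫ x in Set.Icc (0 : ℝ) 1, x ^ n ∂μ) : CompletelyMonotoneSeq a := by
  intro k n
  -- The alternating sum is (1 - 1)^n = 0^n, equal to 1 when n = 0.
  have hconst : 0 ≤ ∑ m ∈ Finset.range (n + 1), (Nat.choose n m : ℝ) * (-1) ^ m := by
    have h := add_pow (-1 : ℝ) 1 n
    simp only [neg_add_cancel, one_pow, mul_one] at h
    rw [Finset.sum_congr rfl fun m _ => mul_comm _ _, ← h]
    positivity
  have hint : ∑ m ∈ Finset.range (n + 1),
      (Nat.choose n m : ℝ) * (-1) ^ m * ∫ x in Set.Icc (0 : ℝ) 1, x ^ (k + m) ∂μ =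
      ∫ x in Set.Icc (0 : ℝ) 1, x ^ k * (1 - x) ^ n ∂μ := by
    simp_rw [← integral_const_mul]
    rw [← integral_finsetSum]
    · refine integral_congr_ae (.of_forall fun x => ?_)
      simp only
      rw [sub_eq_neg_add, add_pow, Finset.mul_sum]
      refine Finset.sum_congr rfl fun m _ => ?_
      rw [neg_pow x, one_pow, pow_add]
      ring
    · intro m _
      exact (Continuous.integrableOn_Icc (by fun_prop))
  have hint0 : 0 ≤ ∫ x in Set.Icc (0 : ℝ) 1, x ^ k * (1 - x) ^ n ∂μ :=
    setIntegral_nonneg measurableSet_Icc fun x hx =>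
      mul_nonneg (pow_nonneg hx.1 k) (pow_nonneg (sub_nonneg.2 hx.2) n)
  have hsum : ∑ m ∈ Finset.range (n + 1), (Nat.choose n m : ℝ) * (-1) ^ m * a (k + m) =
      b * ∑ m ∈ Finset.range (n + 1), (Nat.choose n m : ℝ) * (-1) ^ m +
      c * ∑ m ∈ Finset.range (n + 1),
        (Nat.choose n m : ℝ) * (-1) ^ m * ∫ x in Set.Icc (0 : ℝ) 1, x ^ (k + m) ∂μ := by
    rw [Finset.mul_sum, Finset.mul_sum, ← Finset.sum_add_distrib]
    refine Finset.sum_congr rfl fun m _ => ?_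
    rw [ha]
    ring
  rw [hsum, hint]
  positivity

theorem theorem2p1 :
    (∃ G : StieltjesFunction ℝ, IsProbDistributionOnUnitInterval G ∧
      ∀ n : ℕ, ((n : ℝ) + 1) * (ramanujanTheta n - 1 / 3) =
        4 / 135 + 37 / 270 * ∫ x in Set.Icc (0 : ℝ) 1, x ^ n ∂G.measure) ∧
    CompletelyMonotoneSeq (fun n : ℕ => ((n : ℝ) + 1) * (ramanujanTheta n - 1 / 3)) := by
  have hmoment : ∀ n : ℕ, ((n : ℝ) + 1) * (ramanujanTheta n - 1 / 3) =
      4 / 135 + 37 / 270 * ∫ x in Set.Icc (0 : ℝ) 1, x ^ n ∂ramanujanMeasure := fun n => by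
    rw [Measure.restrict_eq_self_of_ae_mem ae_mem_Icc_ramanujanMeasure,
      integral_pow_ramanujanMeasure]
    ring
  refine ⟨⟨ProbabilityTheory.cdf ramanujanMeasure,
    isProbDistributionOnUnitInterval_cdf ae_mem_Icc_ramanujanMeasure, fun n => ?_⟩,
    completelyMonotoneSeq_of_moments (by norm_num) (by norm_num) hmoment⟩
  rw [ProbabilityTheory.measure_cdf]
  exact hmoment n
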